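/- Let $\mathcal H$ be a (complex) reproducing kernel Hilbert space on a set $X$ with kernel $k$. Let $\mathrm{Mult}(\mathcal H)$ be the algebra of functions $\varphi: X\to\mathbb C$ with $\varphi f\in\mathcal H$ for all $f\in\mathcal H$, with the norm $\|\varphi\|_{\mathrm{Mult}(\mathcal H)}=\|M_\varphi\|$, where $M_\varphi$ is the (bounded) multiplication operator $f\mapsto\varphi f$ on $\mathcal H$. A multiplier is called cyclic if $M_\varphi$ has dense range. The space $\mathcal H$ is a complete Pick space if for all $r,n\in\mathbb N$, all points $z_1,\dots,z_n\in X$ and all $W_1,\dots,W_n\in M_r(\mathbb C)$, positive semidefiniteness of the block matrix $[k(z_i,z_j)(I-W_iW_j^*)]_{i,j=1}^n$ implies that there is $\Phi\in M_r(\mathrm{Mult}(\mathcal H))$, of norm at most $1$ as an operator on $\mathcal H^r$, such that $\Phi(z_i)=W_i$ for all $i$. Put $$N^+(\mathcal H)=\{\varphi/\psi:\ \varphi,\psi\in\mathrm{Mult}(\mathcal H),\ \psi\text{ cyclic}\}.$$ Suppose that $\mathcal H$ is a complete Pick space whose kernel is normalized at $x_0\in X$, that is, $k(x,x_0)=1$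 for all $x\in X$. Then for every $f\in\mathcal H$ with $\|f\|_{\mathcal H}\le 1$ there are $\varphi,\psi\in\mathrm{Mult}(\mathcal H)$ of multiplier norm at most $1$ with $\psi(x_0)=0$ such that $1-\psi$ is a cyclic multiplier without zeros on $X$ and $$f=\frac{\varphi}{1-\psi}.$$ In particular, $\mathcal H\subset N^+(\mathcal H)$. -/

import Mathlib

namespace PickSpace

open scoped ComplexOrder

section

variable {X : Type*} (H : Type*) [NormedAddCommGroup H] [InnerProductSpace ℂ H]
  [RKHS ℂ H X ℂ]

/-- The multiplier algebra: all functions `φ : X → ℂ` with `φ f ∈ H` for all `f ∈ H`. -/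
def Mult : Subalgebra ℂ (X → ℂ) where
  carrier := {φ | ∀ f : H, ∃ g : H, (g : X → ℂ) = φ * (f : X → ℂ)}
  mul_mem' := by
    intro φ ψ hφ hψ f
    obtain ⟨g, hg⟩ := hψ f
    obtain ⟨h, hh⟩ := hφ g
    exact ⟨h, by rw [hh, hg, mul_assoc]⟩
  add_mem' := by
    intro φ ψ hφ hψ f
    obtain ⟨g, hg⟩ := hφ f
    obtain ⟨h, hh⟩ := hψ f
    exact ⟨g + h, by rw [RKHS.coe_add, hg, hh, add_mul]⟩
  algebraMap_mem' := by
    intro c f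
    exact ⟨c • f, by rw [RKHS.coe_smul, Algebra.smul_def]⟩

variable {H}

/-- The element `φ f` of `H`. -/
noncomputable def mulFun (φ : Mult (X := X) H) (f : H) : H := Classical.choose (φ.2 f)

theorem mulFun_apply (φ : Mult (X := X) H) (f : H) (x : X) :
    mulFun φ f x = (φ : X → ℂ) x * f x :=
  congrFun (Classical.choose_spec (φ.2 f)) x

/-- Multiplication by a multiplier, as a linear map on `H`. -/
noncomputable def mulLin (φ : Mult (X := X) H) : H →ₗ[ℂ] H where
  toFun := mulFun φ
  map_add' f g := by
    apply RKHS.ext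
    intro x
    simp [mulFun_apply, mul_add]
  map_smul' c f := by
    apply RKHS.ext
    intro x
    simp [mulFun_apply, mul_left_comm]

theorem mulLin_apply (φ : Mult (X := X) H) (f : H) (x : X) :
    mulLin φ f x = (φ : X → ℂ) x * f x :=
  mulFun_apply φ f x

variable (H)

variable [CompleteSpace H]

/-- The scalar reproducing kernel `k(z, w)` of a Hilbert space `H` of complex-valued functions. -/
noncomputable def k (z w : X) : ℂ := RKHS.kernel H z w 1

/-- `k(z, w) = k_w(z)`, where `k_w` is the element of `H` that represents evaluation at `w`. -/
theorem k_eq (z w : X) : k H z w = RKHS.kerFun H w 1 z :=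
  (RKHS.kerFun_apply H w 1 z).symm

/-- The kernel is normalized at `x₀`. -/
def IsNormalizedAt (x₀ : X) : Prop := ∀ x : X, k H x x₀ = 1

variable {H}

/-- The multiplication operator `M_φ` on `H`; it is bounded by the closed graph theorem. -/
noncomputable def mulOp (φ : Mult (X := X) H) : H →L[ℂ] H :=
  ContinuousLinearMap.ofSeqClosedGraph (g := mulLin φ) (by
    intro u f g hu hg
    apply RKHS.ext
    intro x
    rw [mulLin_apply]
    have h1 := ((RKHS.continuous_eval (H := H) x).tendsto g).comp hg
    have h2 := (((RKHS.continuous_eval (H := H) x).tendsto f).comp hu).const_mul ((φ : X → ℂ) x)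
    refine tendsto_nhds_unique h1 (h2.congr fun n => ?_)
    exact (mulLin_apply φ (u n) x).symm)

theorem mulOp_apply (φ : Mult (X := X) H) (f : H) (x : X) :
    mulOp φ f x = (φ : X → ℂ) x * f x :=
  mulLin_apply φ f x

/-- The multiplier norm. -/
noncomputable def multNorm (φ : Mult (X := X) H) : ℝ := ‖mulOp φ‖

/-- A multiplier is cyclic if its multiplication operator has dense range. -/
def IsCyclicMult (φ : Mult (X := X) H) : Prop := DenseRange (mulOp φ)

/-- The operator of an `r × r` matrix of multipliers on the Hilbert space direct sum of `r`
copies of `H`: the `i`-th component of `Φ h` is `∑ j, Φ i j * h j`. -/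
noncomputable def matMulOp {r : ℕ} (Φ : Matrix (Fin r) (Fin r) (Mult (X := X) H)) :
    PiLp 2 (fun _ : Fin r => H) →L[ℂ] PiLp 2 (fun _ : Fin r => H) :=
  ((PiLp.continuousLinearEquiv 2 ℂ (fun _ : Fin r => H)).symm :
      (Fin r → H) →L[ℂ] PiLp 2 (fun _ : Fin r => H)) ∘L
    ContinuousLinearMap.pi fun i =>
      ∑ j, mulOp (Φ i j) ∘L PiLp.proj (𝕜 := ℂ) 2 (fun _ : Fin r => H) j

theorem matMulOp_apply {r : ℕ} (Φ : Matrix (Fin r) (Fin r) (Mult (X := X) H))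
    (h : PiLp 2 (fun _ : Fin r => H)) (i : Fin r) :
    matMulOp Φ h i = ∑ j, mulOp (Φ i j) (h j) := by
  simp [matMulOp]

variable (H)

/-- The block matrix `[k(z_i, z_j) (I - W_i W_j^*)]`. -/
noncomputable def pickMatrix {n r : ℕ} (z : Fin n → X) (W : Fin n → Matrix (Fin r) (Fin r) ℂ) :
    Matrix (Fin n × Fin r) (Fin n × Fin r) ℂ :=
  Matrix.of fun p q => k H (z p.1) (z q.1) * (1 - W p.1 * (W q.1).conjTranspose) p.2 q.2

/-- `H` is a complete Pick space: every matrix-valued finite interpolation problem whose Pick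
matrix is positive semidefinite has a solution in the unit ball of `M_r(Mult H)`. -/
def IsCompletePick : Prop :=
  ∀ (r n : ℕ) (z : Fin n → X) (W : Fin n → Matrix (Fin r) (Fin r) ℂ),
    (pickMatrix H z W).PosSemidef →
      ∃ Φ : Matrix (Fin r) (Fin r) (Mult (X := X) H),
        ‖matMulOp Φ‖ ≤ 1 ∧ ∀ i a b, (Φ a b : X → ℂ) (z i) = W i a b

/-- The Smirnov class `N⁺(H)` of quotients of a multiplier by a cyclic multiplier. -/
def smirnov : Set (X → ℂ) :=
  {g | ∃ φ ψ : Mult (X := X) H, IsCyclicMult ψ ∧ g = fun x => (φ : X → ℂ) x / (ψ : X → ℂ) x}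

end

end PickSpace

/-! The complete Pick property forces `1 - 1/k` to be positive semidefinite
(`posSemidef_one_sub_inv`), so `1 - 1/k(x, y) = ⟪b x, b y⟫`. Since `1 + (1 - 1/k) k = k`, the
vectors `(1, b x ⊗ k_x)` have Gram matrix `k`. They therefore give a contraction from `ℂ ⊕ G ⊗ H` to
`H`, and its restriction to `b w ⊗ H` is `R w`, multiplication by `1 - 1/k(·, w)`, of norm below 1.
In particular `k_w = 1 + R w k_w`.

For a unit vector `f`, let `P` project onto the orthocomplement of `f`. Cutting this fixed-point
equation with `P` gives `u w = 1 + R w (P (u w))` and `v w = f + P (R w (v w))`, and then `k_w = u w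
+ conj (f w) • R w (v w)`. Pairing with `f` yields `f = φ + ψ f`, where `φ w = ⟪u w, f⟫` and `ψ w =
⟪R w (v w), f⟫`. Contractivity of the big operator makes `k (1 - φ φ*)` and `k (1 - ψ ψ*)` positive,
hence `φ` and `ψ` contractive multipliers. Cyclicity of `1 - ψ` follows because a contraction and
its adjoint have the same fixed vectors. -/

namespace PickSpace

open scoped ComplexOrder InnerProductSpace ComplexConjugate Matrix TensorProduct

universe u

/-! ### Positive semidefinite kernels and Gram matrices -/

section PosSemidef

/-- A matrix is positive semidefinite as soon as all its finite submatrices are. -/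
theorem posSemidef_of_forall_fin {ι : Type*} {A : Matrix ι ι ℂ}
    (h : ∀ (n : ℕ) (z : Fin n → ι), (A.submatrix z z).PosSemidef) : A.PosSemidef := by
  classical
  refine ⟨?_, fun x => ?_⟩
  · ext i j
    have := (h 2 ![i, j]).1.apply 0 1
    simpa using this
  · have hs : (A.submatrix (↑) (↑) : Matrix x.support x.support ℂ).PosSemidef := by
      have h1 := (h _ fun i => ((x.support.equivFin.symm i : x.support) : ι)).submatrix
        x.support.equivFin
      simpa [Matrix.submatrix_submatrix, Function.comp_def] using h1
    simpa [Finsupp.sum, ← Finset.sum_attach x.support, ← Finset.subtype_mem_eq_attach,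
      ← Finsupp.subtypeDomain_apply, ← Finsupp.support_subtypeDomain] using hs.2 _

theorem posSemidef_hadamard {ι : Type*} {A B : Matrix ι ι ℂ} (hA : A.PosSemidef)
    (hB : B.PosSemidef) : (A ⊙ B).PosSemidef :=
  Matrix.PosSemidef.hadamard hA hB

open scoped MatrixOrder in
theorem exists_eq_conjTranspose_mul_self {n : Type*} [Fintype n] {A : Matrix n n ℂ}
    (hA : A.PosSemidef) : ∃ C : Matrix n n ℂ, A = Cᴴ * C := by
  classical
  exact CStarAlgebra.nonneg_iff_eq_star_mul_self.1 (Matrix.nonneg_iff_posSemidef.2 hA)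

variable {ι E F : Type*} [NormedAddCommGroup E] [InnerProductSpace ℂ E]
  [NormedAddCommGroup F] [InnerProductSpace ℂ F]

theorem sum_star_mul_inner_mul (c : ι →₀ ℂ) (v : ι → E) :
    (c.sum fun i ci => c.sum fun j cj => star ci * ⟪v i, v j⟫_ℂ * cj) =
      ((‖Finsupp.linearCombination ℂ v c‖ ^ 2 : ℝ) : ℂ) := by
  have h := inner_self_eq_norm_sq_to_K (𝕜 := ℂ) (Finsupp.linearCombination ℂ v c)
  rw [Complex.ofReal_pow]
  refine Eq.trans ?_ h
  rw [Finsupp.linearCombination_apply, Finsupp.sum_inner]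
  refine Finsupp.sum_congr fun i _ => ?_
  rw [Finsupp.inner_sum]
  refine Finsupp.sum_congr fun j _ => ?_
  simp only [inner_smul_left, inner_smul_right, RCLike.star_def]
  ring

/-- Domination of one family of vectors by another, in terms of Gram matrices. -/
theorem posSemidef_gram_sub_gram_iff (v : ι → E) (u : ι → F) :
    (Matrix.of fun i j => ⟪v i, v j⟫_ℂ - ⟪u i, u j⟫_ℂ).PosSemidef ↔
      ∀ c : ι →₀ ℂ,
        ‖Finsupp.linearCombination ℂ u c‖ ≤ ‖Finsupp.linearCombination ℂ v c‖ := by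
  have key : ∀ c : ι →₀ ℂ, (c.sum fun i ci => c.sum fun j cj =>
      star ci * (Matrix.of fun i j => ⟪v i, v j⟫_ℂ - ⟪u i, u j⟫_ℂ) i j * cj) =
      ((‖Finsupp.linearCombination ℂ v c‖ ^ 2 -
        ‖Finsupp.linearCombination ℂ u c‖ ^ 2 : ℝ) : ℂ) := by
    intro c
    rw [Complex.ofReal_sub, ← sum_star_mul_inner_mul, ← sum_star_mul_inner_mul]
    simp [Finsupp.sum, mul_sub, sub_mul, Finset.sum_sub_distrib]
  constructor
  · intro h c
    have := h.2 c
    rw [key, Complex.zero_le_real, sub_nonneg] at this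
    exact (sq_le_sq₀ (norm_nonneg _) (norm_nonneg _)).1 this
  · intro h
    refine ⟨?_, fun c => ?_⟩
    · ext i j
      simp
    · rw [key, Complex.zero_le_real, sub_nonneg]
      exact pow_le_pow_left₀ (norm_nonneg _) (h c) 2

theorem posSemidef_inner (v : ι → E) : (Matrix.of fun i j => ⟪v i, v j⟫_ℂ).PosSemidef := by
  have := (posSemidef_gram_sub_gram_iff v (fun _ : ι => (0 : ℂ))).2 (fun c => by
    simp [Finsupp.linearCombination_apply])
  simpa using this

theorem posSemidef_inner_sub_inner_map (T : E →L[ℂ] F) (hT : ‖T‖ ≤ 1) (v : ι → E) :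
    (Matrix.of fun i j => ⟪v i, v j⟫_ℂ - ⟪T (v i), T (v j)⟫_ℂ).PosSemidef := by
  refine (posSemidef_gram_sub_gram_iff v fun i => T (v i)).2 fun c => ?_
  have : Finsupp.linearCombination ℂ (fun i => T (v i)) c =
      T (Finsupp.linearCombination ℂ v c) := by
    simp [Finsupp.linearCombination_apply, Finsupp.sum, map_sum]
  rw [this]
  simpa using T.le_of_opNorm_le hT _

/-- An off-diagonal entry of a positive semidefinite matrix vanishes next to a zero on the
diagonal. -/
theorem eq_zero_of_posSemidef_of_diag_eq_zero {A : Matrix ι ι ℂ} (hA : A.PosSemidef) {i j : ι}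
    (hi : A i i = 0) : A i j = 0 := by
  have h2 := (hA.submatrix ![i, j])
  have hd := h2.det_nonneg
  have hh := hA.1.apply i j
  rw [Matrix.det_fin_two] at hd
  simp [hi] at hd hh
  rw [← hh, ← Complex.normSq_eq_conj_mul_self] at hd
  have h3 : Complex.normSq (A j i) ≤ 0 := by
    have := Complex.le_def.1 hd
    simpa using this.1
  have h4 : A j i = 0 := Complex.normSq_eq_zero.1 (le_antisymm h3 (Complex.normSq_nonneg _))
  rw [← hh, h4, map_zero]

/-- A positive semidefinite kernel is the kernel of inner products of a family of vectors. -/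
theorem exists_inner_eq_of_posSemidef {X : Type u} {g : X → X → ℂ}
    (hg : (Matrix.of g).PosSemidef) :
    ∃ (G : Type u) (_ : NormedAddCommGroup G) (_ : InnerProductSpace ℂ G) (b : X → G),
      ∀ x y, ⟪b x, b y⟫_ℂ = g x y := by
  let K : Matrix X X (ℂ →L[ℂ] ℂ) := Matrix.of fun x y => g x y • ContinuousLinearMap.id ℂ ℂ
  have hK : K.PosSemidef := by
    have htfae : K.PosSemidef ↔ _ := (RKHS.posSemidef_tfae (K := K)).out 0 2
    refine htfae.2 ⟨?_, fun v => ?_⟩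
    · ext x y
      have := hg.1.apply x y
      simp at this
      simp [K, this, ContinuousLinearMap.star_eq_adjoint, ContinuousLinearMap.adjoint_id]
    · have h := hg.2 v
      have e : (v.sum fun x w => v.sum fun x' w' => ⟪K x' x w, w'⟫_ℂ) = conj
          (v.sum fun i xi => v.sum fun j xj => star xi * (Matrix.of g) i j * xj) := by
        rw [Finsupp.sum_comm]
        simp [K, Finsupp.sum, map_sum]
        refine Finset.sum_congr rfl fun i _ => Finset.sum_congr rfl fun j _ => ?_
        ring
      rw [e]
      have := (Complex.le_def.1 h).1
      simpa using this
  have : Fact K.PosSemidef := ⟨hK⟩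
  refine ⟨RKHS.OfKernel K, inferInstance, inferInstance,
    fun x => RKHS.kerFun (RKHS.OfKernel K) x 1, fun x y => ?_⟩
  rw [RKHS.kerFun_inner, RKHS.kerFun_apply, RKHS.OfKernel.kernel_ofKernel]
  simp [K]

end PosSemidef

/-! ### Contractions into `H`, multipliers and cyclicity -/

section Kernel

variable {X H : Type*} [NormedAddCommGroup H] [InnerProductSpace ℂ H] [CompleteSpace H]
  [RKHS ℂ H X ℂ]

variable (H) in
/-- The kernel function at `x`, the element of `H` that represents evaluation at `x`. -/
noncomputable def kerVec (x : X) : H := RKHS.kerFun H x 1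

theorem inner_kerVec_left (x : X) (f : H) : ⟪kerVec H x, f⟫_ℂ = f x := by
  simp [kerVec]

theorem inner_kerVec_kerVec (x y : X) : ⟪kerVec H x, kerVec H y⟫_ℂ = k H x y := by
  rw [inner_kerVec_left, k_eq, kerVec]

theorem kerVec_apply (x y : X) : kerVec H y x = k H x y := by
  rw [k_eq, kerVec]

theorem conj_k (x y : X) : conj (k H x y) = k H y x := by
  rw [← inner_kerVec_kerVec, ← inner_kerVec_kerVec, inner_conj_symm]

variable (H) in
theorem posSemidef_k : (Matrix.of fun x y : X => k H x y).PosSemidef := by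
  simpa only [inner_kerVec_kerVec] using posSemidef_inner (kerVec H : X → H)

theorem k_self_eq_norm_sq (x : X) : k H x x = ((‖kerVec H x‖ ^ 2 : ℝ) : ℂ) := by
  rw [← inner_kerVec_kerVec, inner_self_eq_norm_sq_to_K]
  simp

variable {E : Type*} [NormedAddCommGroup E] [InnerProductSpace ℂ E]

/-- Domination makes `∑ c x • k_x ↦ ⟪v, ∑ c x • e x⟫` a well-defined functional of norm at most
`‖v‖`; Hahn–Banach and Riesz then produce `g`. -/
theorem exists_eval_eq_inner {e : X → E}
    (he : (Matrix.of fun x y => k H x y - ⟪e x, e y⟫_ℂ).PosSemidef) (v : E) :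
    ∃ g : H, ‖g‖ ≤ ‖v‖ ∧ ∀ x, g x = ⟪e x, v⟫_ℂ := by
  let L₁ : (X →₀ ℂ) →ₗ[ℂ] H := Finsupp.linearCombination ℂ (kerVec H)
  let L₂ : (X →₀ ℂ) →ₗ[ℂ] E := Finsupp.linearCombination ℂ e
  have hle : ∀ c, ‖L₂ c‖ ≤ ‖L₁ c‖ := by
    refine (posSemidef_gram_sub_gram_iff (kerVec H) e).1 ?_
    simpa only [inner_kerVec_kerVec] using he
  -- The choice of linear section is immaterial: by `hle`, `L₂` vanishes on the kernel of `L₁`.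
  obtain ⟨s, hs⟩ := L₁.rangeRestrict.exists_rightInverse_of_surjective L₁.range_rangeRestrict
  have hs' : ∀ y, L₁ (s y) = (y : H) := fun y =>
    congrArg Subtype.val (LinearMap.congr_fun hs y)
  let p : LinearMap.range L₁ →ₗ[ℂ] ℂ := (innerSL ℂ v : E →ₗ[ℂ] ℂ) ∘ₗ L₂ ∘ₗ s
  have hp : ∀ y, ‖p y‖ ≤ ‖v‖ * ‖y‖ := fun y => by
    calc ‖⟪v, L₂ (s y)⟫_ℂ‖ ≤ ‖v‖ * ‖L₂ (s y)‖ := norm_inner_le_norm _ _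
      _ ≤ ‖v‖ * ‖y‖ := by
        gcongr
        simpa [hs'] using hle (s y)
  obtain ⟨q, hq, hqn⟩ := exists_extension_norm_eq _ (p.mkContinuous ‖v‖ hp)
  refine ⟨(InnerProductSpace.toDual ℂ H).symm q, ?_, fun x => ?_⟩
  · rw [LinearIsometryEquiv.norm_map, hqn]
    exact p.mkContinuous_norm_le (norm_nonneg _) hp
  · have hx : kerVec H x = L₁ (Finsupp.single x 1) := by simp [L₁]
    have h0 : L₂ (s ⟨kerVec H x, _, hx.symm⟩) = e x := by
      have h1 := hle (s ⟨kerVec H x, _, hx.symm⟩ - Finsupp.single x 1)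
      have h2 : L₁ (s ⟨kerVec H x, _, hx.symm⟩ - Finsupp.single x 1) = 0 := by
        rw [map_sub, hs', sub_eq_zero]
        exact hx
      rw [h2, norm_zero, norm_le_zero_iff, map_sub, sub_eq_zero] at h1
      rw [h1]
      simp [L₂]
    rw [← inner_kerVec_left, ← inner_conj_symm, InnerProductSpace.toDual_symm_apply]
    have h3 := hq ⟨kerVec H x, _, hx.symm⟩
    rw [h3]
    simp [p, h0]

/-- A family of vectors dominated by the kernel functions induces a contraction into `H`. -/
theorem exists_contraction_eval_eq_inner {e : X → E}
    (he : (Matrix.of fun x y => k H x y - ⟪e x, e y⟫_ℂ).PosSemidef) :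
    ∃ T : E →L[ℂ] H, ‖T‖ ≤ 1 ∧ ∀ v x, T v x = ⟪e x, v⟫_ℂ := by
  choose T hT hTe using exists_eval_eq_inner he
  let L : E →ₗ[ℂ] H :=
    { toFun := T
      map_add' := fun u v => RKHS.ext fun x => by simp [hTe]
      map_smul' := fun c v => RKHS.ext fun x => by simp [hTe] }
  have hL : ∀ v, ‖L v‖ ≤ 1 * ‖v‖ := fun v => (hT v).trans (one_mul _).ge
  exact ⟨L.mkContinuous 1 hL, L.mkContinuous_norm_le zero_le_one hL, hTe⟩

/-- A function `φ` with `k(x, y) (1 - φ(x) conj φ(y))` positive semidefinite is a contractive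
multiplier. -/
theorem exists_mult_of_posSemidef {φ : X → ℂ}
    (h : (Matrix.of fun x y => k H x y * (1 - φ x * conj (φ y))).PosSemidef) :
    ∃ Φ : Mult (X := X) H, (Φ : X → ℂ) = φ ∧ multNorm Φ ≤ 1 := by
  obtain ⟨T, hT, hTe⟩ := exists_contraction_eval_eq_inner (H := H)
    (e := fun x => conj (φ x) • kerVec H x) (by
      convert h using 4 with x y
      rw [inner_smul_left, inner_smul_right, inner_kerVec_kerVec, Complex.conj_conj]
      ring)
  have hT' : ∀ f x, T f x = φ x * f x := fun f x => by
    rw [hTe, inner_smul_left, inner_kerVec_left, Complex.conj_conj]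
  refine ⟨⟨φ, fun f => ⟨T f, funext (hT' f)⟩⟩, rfl, ?_⟩
  rw [multNorm]
  convert hT
  ext f x
  rw [mulOp_apply, hT']

/-- A contraction and its adjoint have the same fixed vectors. -/
theorem apply_eq_self_of_adjoint_apply_eq_self {C : H →L[ℂ] H} (hC : ‖C‖ ≤ 1) {h : H}
    (hh : C.adjoint h = h) : C h = h := by
  have h1 : ⟪C h, h⟫_ℂ = ((‖h‖ ^ 2 : ℝ) : ℂ) := by
    rw [← ContinuousLinearMap.adjoint_inner_right, hh, inner_self_eq_norm_sq_to_K]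
    simp
  have h2 : ‖C h‖ ≤ ‖h‖ := by simpa using C.le_of_opNorm_le hC h
  have h3 : ‖C h - h‖ ^ 2 ≤ 0 := by
    rw [norm_sub_sq (𝕜 := ℂ), h1]
    have := pow_le_pow_left₀ (norm_nonneg _) h2 2
    simp only [RCLike.re_to_complex, Complex.ofReal_re]
    linarith
  exact sub_eq_zero.1 (norm_eq_zero.1 (pow_eq_zero_iff two_ne_zero |>.1
    (le_antisymm h3 (sq_nonneg _))))

/-- A vector orthogonal to the range is fixed by the adjoint of `mulOp ψ`, hence by `mulOp ψ`
itself, so `(1 - ψ) h = 0` pointwise. -/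
theorem isCyclicMult_one_sub {ψ : Mult (X := X) H} (hψ : multNorm ψ ≤ 1)
    (h1 : ∀ x, 1 - (ψ : X → ℂ) x ≠ 0) : IsCyclicMult (1 - ψ) := by
  have hop : mulOp (1 - ψ) = 1 - mulOp ψ := by
    ext f x
    simp [mulOp_apply, sub_mul]
  have hbot : (LinearMap.range (mulOp (1 - ψ)).toLinearMap)ᗮ = ⊥ := by
    rw [Submodule.eq_bot_iff]
    intro h hh
    have h2 : (mulOp ψ).adjoint h = h := by
      refine ext_inner_left ℂ fun f => ?_
      have := (Submodule.mem_orthogonal _ _).1 hh _ ⟨f, rfl⟩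
      simp [hop, inner_sub_left] at this
      rw [ContinuousLinearMap.adjoint_inner_right]
      exact (sub_eq_zero.1 this).symm
    have h3 := apply_eq_self_of_adjoint_apply_eq_self hψ h2
    refine RKHS.ext fun x => ?_
    have h4 : (ψ : X → ℂ) x * h x = h x := by rw [← mulOp_apply, h3]
    have h5 : (1 - (ψ : X → ℂ) x) * h x = 0 := by rw [sub_mul, h4, one_mul, sub_self]
    simpa using (mul_eq_zero.1 h5).resolve_left (h1 x)
  have htop := Submodule.topologicalClosure_eq_top_iff.2 hbot
  have hd := Submodule.dense_iff_topologicalClosure_eq_top.2 htop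
  exact hd

end Kernel

/-! ### Positivity of `1 - 1/k` from the complete Pick property -/

section CompletePick

variable {X H : Type*} [NormedAddCommGroup H] [InnerProductSpace ℂ H] [CompleteSpace H]
  [RKHS ℂ H X ℂ]

variable (H) in
/-- The kernel of the subspace of the functions in `H` that vanish at `p`. -/
noncomputable def kVanish (p x y : X) : ℂ := k H x y - k H x p * k H p y / k H p p

theorem inner_starProjection_kerVec (p x y : X) :
    ⟪(ℂ ∙ kerVec H p)ᗮ.starProjection (kerVec H x),
      (ℂ ∙ kerVec H p)ᗮ.starProjection (kerVec H y)⟫_ℂ = kVanish H p x y := by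
  rw [Submodule.inner_starProjection_left_eq_right,
    Submodule.starProjection_eq_self_iff.2 (Submodule.starProjection_apply_mem _ _),
    Submodule.starProjection_orthogonal_val, Submodule.starProjection_singleton, inner_sub_right,
    inner_smul_right, inner_kerVec_kerVec, inner_kerVec_kerVec, inner_kerVec_kerVec, kVanish,
    k_self_eq_norm_sq p]
  simp only [Complex.coe_algebraMap]
  ring

/-- A contractive row of multipliers acts contractively on the functions that vanish at `p`. -/
theorem posSemidef_kVanish_of_row {r : ℕ} {φ : Fin r → Mult (X := X) H}
    (A : PiLp 2 (fun _ : Fin r => H) →L[ℂ] H) (hA : ‖A‖ ≤ 1)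
    (hAφ : ∀ h x, A h x = ∑ l, (φ l : X → ℂ) x * h l x) (p : X) :
    (Matrix.of fun x y => kVanish H p x y *
      (1 - ∑ l, (φ l : X → ℂ) x * conj ((φ l : X → ℂ) y))).PosSemidef := by
  set P : H →L[ℂ] H := (ℂ ∙ kerVec H p)ᗮ.starProjection with hP
  have hPk : ∀ h : H, (P h) p = 0 := fun h => by
    rw [← inner_kerVec_left]
    exact Submodule.mem_orthogonal_singleton_iff_inner_right.1
      (Submodule.starProjection_apply_mem _ _)
  have hPs : ∀ f h : H, ⟪P f, h⟫_ℂ = ⟪f, P h⟫_ℂ :=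
    Submodule.inner_starProjection_left_eq_right _
  have hPfix : ∀ h : H, h p = 0 → P h = h := fun h hh =>
    Submodule.starProjection_eq_self_iff.2
      (Submodule.mem_orthogonal_singleton_iff_inner_right.2 (by rw [inner_kerVec_left, hh]))
  let Q : PiLp 2 (fun _ : Fin r => H) →ₗ[ℂ] PiLp 2 (fun _ : Fin r => H) :=
    { toFun := fun h => WithLp.toLp 2 fun l => P (h l)
      map_add' := fun _ _ => by ext; simp
      map_smul' := fun _ _ => by ext; simp }
  have hQ : ∀ h, ‖Q h‖ ≤ 1 * ‖h‖ := fun h => by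
    rw [one_mul, ← sq_le_sq₀ (norm_nonneg _) (norm_nonneg _), PiLp.norm_sq_eq_of_L2,
      PiLp.norm_sq_eq_of_L2]
    refine Finset.sum_le_sum fun l _ => ?_
    exact pow_le_pow_left₀ (norm_nonneg _) (Submodule.norm_starProjection_apply_le _ _) 2
  let T : H →L[ℂ] PiLp 2 (fun _ : Fin r => H) := (A ∘L Q.mkContinuous 1 hQ).adjoint
  have hT : ‖T‖ ≤ 1 := by
    rw [LinearIsometryEquiv.norm_map]
    refine (ContinuousLinearMap.opNorm_comp_le _ _).trans ?_
    exact mul_le_one₀ hA (norm_nonneg _) (Q.mkContinuous_norm_le zero_le_one hQ)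
  have hTk : ∀ x, T (P (kerVec H x)) =
      WithLp.toLp 2 fun l => conj ((φ l : X → ℂ) x) • P (kerVec H x) := by
    intro x
    refine ext_inner_right ℂ fun h => ?_
    -- The components of `Q h` vanish at `p`, and multiplication preserves this.
    have h1 : P (A (Q h)) = A (Q h) := hPfix _ (by simp [hAφ, Q, hPk])
    rw [ContinuousLinearMap.adjoint_inner_left, hPs]
    change ⟪kerVec H x, P (A (Q h))⟫_ℂ = _
    rw [h1, inner_kerVec_left, hAφ, PiLp.inner_apply]
    refine Finset.sum_congr rfl fun l _ => ?_
    simp only [inner_smul_left, hPs, inner_kerVec_left, Complex.conj_conj]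
    rfl
  convert posSemidef_inner_sub_inner_map T hT (fun x => P (kerVec H x)) using 4 with x y
  rw [hTk, hTk, PiLp.inner_apply]
  simp only [inner_smul_left, inner_smul_right, Complex.conj_conj, hP,
    inner_starProjection_kerVec]
  rw [mul_sub, mul_one, Finset.mul_sum]
  congr 1
  exact Finset.sum_congr rfl fun l _ => by ring

/-- In a complete Pick space, a contractive interpolation problem for rows stays contractive on
the functions that vanish at `p`. -/
theorem IsCompletePick.posSemidef_kVanish (hH : IsCompletePick (X := X) H) (p : X) {r n : ℕ}
    (z : Fin n → X) (w : Fin n → Fin (r + 1) → ℂ)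
    (h : (Matrix.of fun i j => k H (z i) (z j) * (1 - ∑ l, w i l * conj (w j l))).PosSemidef) :
    (Matrix.of fun i j => kVanish H p (z i) (z j) *
      (1 - ∑ l, w i l * conj (w j l))).PosSemidef := by
  -- The row is padded with zero rows to a square matrix; the Pick matrix splits into the given one
  -- in the corner and copies of `k` along the rest of the diagonal.
  let W : Fin n → Matrix (Fin (r + 1)) (Fin (r + 1)) ℂ := fun i =>
    Matrix.of fun a l => if a = 0 then w i l else 0
  have hW : (pickMatrix H z W).PosSemidef := by
    have h1 := posSemidef_hadamard (h.submatrix (Prod.fst : Fin n × Fin (r + 1) → Fin n))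
      ((Matrix.posSemidef_vecMulVec_self_star
        (fun a : Fin (r + 1) => if a = 0 then (1 : ℂ) else 0)).submatrix
        (Prod.snd : Fin n × Fin (r + 1) → Fin (r + 1)))
    have h2 := posSemidef_hadamard
      ((posSemidef_k H).submatrix (fun q : Fin n × Fin (r + 1) => z q.1))
      ((Matrix.PosSemidef.diagonal (d := fun a : Fin (r + 1) => if a = 0 then (0 : ℂ) else 1)
        (fun a => by by_cases ha : a = 0 <;> simp [ha])).submatrix
        (Prod.snd : Fin n × Fin (r + 1) → Fin (r + 1)))
    convert h1.add h2 using 1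
    ext ⟨i, a⟩ ⟨j, b⟩
    simp only [pickMatrix, W, Matrix.of_apply, Matrix.add_apply, Matrix.hadamard_apply,
      Matrix.submatrix_apply, Matrix.vecMulVec_apply, Matrix.sub_apply, Matrix.mul_apply,
      Matrix.conjTranspose_apply, Matrix.diagonal_apply, Matrix.one_apply, Pi.star_apply]
    by_cases ha : a = 0 <;> by_cases hb : b = 0 <;> by_cases hab : a = b <;> simp_all
  obtain ⟨Φ, hΦ, hΦW⟩ := hH (r + 1) n z W hW
  have hrow := posSemidef_kVanish_of_row (φ := Φ 0)
    ((PiLp.proj 2 (fun _ : Fin (r + 1) => H) 0 : _ →L[ℂ] H) ∘L matMulOp Φ) (by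
      refine ContinuousLinearMap.opNorm_le_bound _ zero_le_one fun h => ?_
      rw [one_mul]
      exact (PiLp.norm_apply_le _ _).trans (by simpa using (matMulOp Φ).le_of_opNorm_le hΦ h))
    (fun h x => by
      have : ∀ s : Finset (Fin (r + 1)), ((∑ j ∈ s, mulOp (Φ 0 j) (h j) : H) x) =
          ∑ j ∈ s, (Φ 0 j : X → ℂ) x * h j x := fun s => by
        rw [← inner_kerVec_left, inner_sum]
        simp only [inner_kerVec_left, mulOp_apply]
      change (matMulOp Φ h 0) x = _
      rw [matMulOp_apply, this]) p
  convert hrow.submatrix z using 1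
  ext i j
  simp [hΦW, W]

/-- In a complete Pick space with normalized kernel, the kernel has no zeros. -/
theorem IsCompletePick.k_ne_zero (hH : IsCompletePick (X := X) H) {x₀ : X}
    (hk : IsNormalizedAt H x₀) (x y : X) : k H x y ≠ 0 := by
  intro h0
  have h0' : k H y x = 0 := by rw [← conj_k, h0, map_zero]
  have hk' : ∀ x, k H x₀ x = 1 := fun x => by rw [← conj_k, hk x, map_one]
  -- If `k x y = 0`, the Pick matrix for the values `1` and `-1` is zero. Passing to functions
  -- vanishing at `x₀` keeps the zero diagonal but makes the off-diagonal entry `-2`.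
  have h := hH.posSemidef_kVanish x₀ (r := 0) ![x, y] ![fun _ => 1, fun _ => -1] (by
    convert Matrix.PosSemidef.zero using 1
    ext i j
    fin_cases i <;> fin_cases j <;> simp [h0, h0'])
  have := eq_zero_of_posSemidef_of_diag_eq_zero h (i := 0) (j := 1) (by simp)
  simp [kVanish, h0, hk _, hk' _] at this

/-- Induction on the number of points. The case of the other points with base point `z 0` yields
rows `w` for which `k (1 - w w*)` has rank one. Their Pick problem is solvable, so it remains
positive on functions vanishing at `p`; dividing out the rank-one factor leaves the claim for `p`.
-/
theorem IsCompletePick.posSemidef_one_sub_div (hH : IsCompletePick (X := X) H) {x₀ : X}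
    (hk : IsNormalizedAt H x₀) : ∀ (n : ℕ) (z : Fin n → X) (p : X),
    (Matrix.of fun i j => 1 - k H (z i) p * k H p (z j) / (k H p p * k H (z i) (z j))).PosSemidef
  | 0, z, p => by
    convert Matrix.PosSemidef.zero using 1
    ext i
    exact i.elim0
  | n + 1, z, p => by
    have h0 := hH.k_ne_zero hk
    set B : Matrix (Fin (n + 1)) (Fin (n + 1)) ℂ := Matrix.of fun i j =>
      1 - k H (z i) (z 0) * k H (z 0) (z j) / (k H (z 0) (z 0) * k H (z i) (z j)) with hB
    have hBpos : B.PosSemidef := by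
      have ih := IsCompletePick.posSemidef_one_sub_div hH hk n (fun i => z i.succ) (z 0)
      obtain ⟨C, hC⟩ := exists_eq_conjTranspose_mul_self ih
      -- Row and column `0` of `B` vanish, so a zero column is prepended to `C`.
      let D : Matrix (Fin n) (Fin (n + 1)) ℂ := Matrix.of fun l =>
        (Fin.cons 0 (C l) : Fin (n + 1) → ℂ)
      have : B = Dᴴ * D := by
        ext i j
        have h00 := h0 (z 0) (z 0)
        refine Fin.cases ?_ (fun i => ?_) i
        · have := h0 (z 0) (z j)
          simp [hB, D, Matrix.mul_apply]
          field_simp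
          simp
        · refine Fin.cases ?_ (fun j => ?_) j
          · have := h0 (z i.succ) (z 0)
            simp [hB, D, Matrix.mul_apply]
            field_simp
            simp
          · have := congrFun (congrFun hC i) j
            simpa [hB, D, Matrix.mul_apply] using this
      rw [this]
      exact Matrix.posSemidef_conjTranspose_mul_self D
    obtain ⟨C, hC⟩ := exists_eq_conjTranspose_mul_self hBpos
    have hsum : ∀ i j, 1 - ∑ l, conj (C l i) * conj (conj (C l j)) =
        k H (z i) (z 0) * k H (z 0) (z j) / (k H (z 0) (z 0) * k H (z i) (z j)) := by
      intro i j
      have := congrFun (congrFun hC i) j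
      simp only [Matrix.mul_apply, Matrix.conjTranspose_apply, RCLike.star_def, hB,
        Matrix.of_apply] at this
      simp only [Complex.conj_conj]
      rw [← this]
      ring
    have hrank : (Matrix.of fun i j => k H (z i) (z 0) * k H (z 0) (z j) /
        k H (z 0) (z 0)).PosSemidef := by
      have h1 := (Matrix.posSemidef_vecMulVec_self_star (fun i => k H (z i) (z 0))).smul
        (a := (1 / ‖kerVec H (z 0)‖ ^ 2 : ℝ)) (by positivity)
      convert h1 using 1
      ext i j
      simp only [Matrix.of_apply, Matrix.smul_apply, Matrix.vecMulVec_apply, Pi.star_apply,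
        RCLike.star_def, conj_k, k_self_eq_norm_sq (z 0), Complex.real_smul]
      push_cast
      ring
    have hstep := hH.posSemidef_kVanish p z (fun i l => conj (C l i)) (by
      convert hrank using 4 with i j
      rw [hsum]
      have := h0 (z 0) (z 0)
      have := h0 (z i) (z j)
      field_simp)
    have hconj := posSemidef_hadamard hstep (Matrix.posSemidef_vecMulVec_self_star
      (fun i => 1 / k H (z i) (z 0)))
    have hfin := hconj.smul (a := ‖kerVec H (z 0)‖ ^ 2) (by positivity)
    convert hfin using 1
    ext i j
    have e1 : ((‖kerVec H (z 0)‖ ^ 2 : ℝ) : ℂ) = k H (z 0) (z 0) := (k_self_eq_norm_sq _).symm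
    simp only [Matrix.of_apply, Matrix.smul_apply, Matrix.hadamard_apply, Matrix.vecMulVec_apply,
      Pi.star_apply, RCLike.star_def, map_div₀, map_one, conj_k, Complex.real_smul, hsum, kVanish,
      e1]
    have := h0 (z 0) (z 0)
    have := h0 (z i) (z j)
    have := h0 (z i) (z 0)
    have := h0 (z 0) (z j)
    have := h0 p p
    field_simp

/-- In a complete Pick space with kernel normalized at a point, `1 - 1/k` is positive
semidefinite. -/
theorem IsCompletePick.posSemidef_one_sub_inv (hH : IsCompletePick (X := X) H) {x₀ : X}
    (hk : IsNormalizedAt H x₀) : (Matrix.of fun x y : X => 1 - (k H x y)⁻¹).PosSemidef := by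
  refine posSemidef_of_forall_fin fun n z => ?_
  have hk' : ∀ x, k H x₀ x = 1 := fun x => by rw [← conj_k, hk x, map_one]
  convert hH.posSemidef_one_sub_div hk n z x₀ using 1
  ext i j
  simp [hk _, hk' _]

end CompletePick

/-! ### The factorization and the Smirnov class -/

section Factorization

theorem exists_eq_add_apply {E : Type*} [NormedAddCommGroup E] [NormedSpace ℂ E]
    [CompleteSpace E] {A : E →L[ℂ] E} (hA : ‖A‖ < 1) (h : E) : ∃ y, y = h + A y := by
  obtain ⟨u, hu⟩ := isUnit_one_sub_of_norm_lt_one hA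
  refine ⟨(↑u⁻¹ : E →L[ℂ] E) h, ?_⟩
  have h1 : ((u : E →L[ℂ] E) * (↑u⁻¹ : E →L[ℂ] E)) h = h := by rw [Units.mul_inv]; rfl
  rw [hu] at h1
  exact sub_eq_iff_eq_add.1 h1

theorem eq_zero_of_eq_apply {E : Type*} [NormedAddCommGroup E] [NormedSpace ℂ E]
    {A : E →L[ℂ] E} (hA : ‖A‖ < 1) {d : E} (hd : d = A d) : d = 0 := by
  by_contra h
  have h1 : 0 < ‖d‖ := norm_pos_iff.2 h
  have h2 := A.le_opNorm d
  rw [← hd] at h2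
  nlinarith

variable {X H : Type*} [NormedAddCommGroup H] [InnerProductSpace ℂ H] [CompleteSpace H]
  [RKHS ℂ H X ℂ]

/-- In a complete Pick space with kernel normalized at `x₀`, multiplication by `1 - 1/k(·, w)` is a
strict contraction for each `w`, and these operators together with the constants are dominated
by the kernel `1 - 1/k`. -/
theorem IsCompletePick.exists_mul_one_sub_inv (hH : IsCompletePick (X := X) H) {x₀ : X}
    (hk : IsNormalizedAt H x₀) :
    ∃ R : X → H →L[ℂ] H, (∀ w, ‖R w‖ < 1) ∧
      (∀ w h x, R w h x = (1 - (k H x w)⁻¹) * h x) ∧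
      ∀ (c : X → ℂ) (h : X → H), (Matrix.of fun x y =>
        conj (c x) * c y + (1 - (k H x y)⁻¹) * ⟪h x, h y⟫_ℂ -
          ⟪c x • kerVec H x₀ + R x (h x), c y • kerVec H x₀ + R y (h y)⟫_ℂ).PosSemidef := by
  have h0 := hH.k_ne_zero hk
  obtain ⟨G, _, _, b, hb⟩ := exists_inner_eq_of_posSemidef (hH.posSemidef_one_sub_inv hk)
  obtain ⟨T, hT, hTe⟩ := exists_contraction_eval_eq_inner (H := H)
    (e := fun x => (WithLp.toLp 2 ((1 : ℂ), b x ⊗ₜ[ℂ] kerVec H x) : WithLp 2 (ℂ × (G ⊗[ℂ] H))))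
    (by
      convert Matrix.PosSemidef.zero using 1
      ext x y
      have := h0 x y
      simp [hb, inner_kerVec_kerVec]
      field_simp
      ring)
  have hTapp : ∀ (c : ℂ) (w : X) (h : H) (x : X),
      T (WithLp.toLp 2 (c, b w ⊗ₜ[ℂ] h)) x = c + (1 - (k H x w)⁻¹) * h x := by
    intro c w h x
    rw [hTe]
    simp [hb, inner_kerVec_left]
  have hbn : ∀ w, ‖b w‖ < 1 := by
    intro w
    have h1 := hb w w
    rw [inner_self_eq_norm_sq_to_K, k_self_eq_norm_sq] at h1
    have h2 : ‖b w‖ ^ 2 = 1 - (‖kerVec H w‖ ^ 2)⁻¹ := by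
      rw [← Complex.ofReal_inj]
      push_cast
      simpa using h1
    have h3 : 0 < ‖kerVec H w‖ ^ 2 := by
      refine lt_of_le_of_ne (sq_nonneg _) fun h => h0 w w ?_
      rw [k_self_eq_norm_sq, ← h, Complex.ofReal_zero]
    have h4 : ‖b w‖ ^ 2 < 1 := by
      rw [h2]
      linarith [inv_pos.2 h3]
    exact lt_of_pow_lt_pow_left₀ 2 zero_le_one (by simpa using h4)
  let L : X → H →ₗ[ℂ] H := fun w =>
    { toFun := fun h => T (WithLp.toLp 2 ((0 : ℂ), b w ⊗ₜ[ℂ] h))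
      map_add' := fun f g => RKHS.ext fun x => by simp [hTapp, mul_add]
      map_smul' := fun c f => RKHS.ext fun x => by
        simp [hTapp, mul_left_comm, -TensorProduct.tmul_smul] }
  have hL : ∀ w h, ‖L w h‖ ≤ ‖b w‖ * ‖h‖ := by
    intro w h
    refine (T.le_of_opNorm_le hT _).trans ?_
    rw [one_mul, ← sq_le_sq₀ (norm_nonneg _) (by positivity), WithLp.prod_norm_sq_eq_of_L2]
    simp
  refine ⟨fun w => (L w).mkContinuous ‖b w‖ (hL w), fun w => ?_, fun w h x => ?_, fun c h => ?_⟩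
  · exact ((L w).mkContinuous_norm_le (norm_nonneg _) (hL w)).trans_lt (hbn w)
  · change T (WithLp.toLp 2 ((0 : ℂ), b w ⊗ₜ[ℂ] h)) x = _
    rw [hTapp, zero_add]
  · have h1 : ∀ x, c x • kerVec H x₀ + L x (h x) =
        T (WithLp.toLp 2 (c x, b x ⊗ₜ[ℂ] h x)) := by
      intro x
      refine RKHS.ext fun y => ?_
      change (c x • kerVec H x₀ + T (WithLp.toLp 2 ((0 : ℂ), b x ⊗ₜ[ℂ] h x))) y = _
      simp [hTapp, kerVec_apply, hk y]
    convert posSemidef_inner_sub_inner_map T hT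
      (fun x => WithLp.toLp 2 (c x, b x ⊗ₜ[ℂ] h x)) using 4 with x y
    rw [← h1, ← h1]
    congr 1
    simp [hb]
    ring

/-- The resolvent equations for `u` and `v` are solvable because `R w` is a strict contraction and
`P` a contraction. -/
theorem IsCompletePick.exists_factorization_of_norm_eq_one (hH : IsCompletePick (X := X) H)
    {x₀ : X} (hk : IsNormalizedAt H x₀) {f : H} (hf : ‖f‖ = 1) :
    ∃ φ ψ : X → ℂ,
      (Matrix.of fun x y => k H x y * (1 - φ x * conj (φ y))).PosSemidef ∧
      (Matrix.of fun x y => k H x y * (1 - ψ x * conj (ψ y))).PosSemidef ∧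
      ψ x₀ = 0 ∧ ∀ x, (1 - ψ x) * f x = φ x := by
  have h0 := hH.k_ne_zero hk
  obtain ⟨R, hR, hRapp, hRpos⟩ := hH.exists_mul_one_sub_inv hk
  set P : H →L[ℂ] H := (ℂ ∙ f)ᗮ.starProjection with hP
  have hPn : ‖P‖ ≤ 1 := Submodule.starProjection_norm_le _
  have hPapp : ∀ h, P h = h - ⟪f, h⟫_ℂ • f := fun h => by
    rw [hP, Submodule.starProjection_orthogonal_val, Submodule.starProjection_unit_singleton ℂ hf]
  have hff : ⟪f, f⟫_ℂ = 1 := by rw [inner_self_eq_norm_sq_to_K, hf]; simp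
  have hPinner : ∀ g h, ⟪g, h⟫_ℂ = ⟪g, f⟫_ℂ * ⟪f, h⟫_ℂ + ⟪P g, P h⟫_ℂ := fun g h => by
    simp only [hPapp, inner_sub_left, inner_sub_right, inner_smul_left, inner_smul_right, hff,
      inner_conj_symm]
    ring
  have hRP : ∀ w, ‖R w ∘L P‖ < 1 := fun w =>
    (ContinuousLinearMap.opNorm_comp_le _ _).trans_lt
      ((mul_le_of_le_one_right (norm_nonneg _) hPn).trans_lt (hR w))
  have hPR : ∀ w, ‖P ∘L R w‖ < 1 := fun w =>
    (ContinuousLinearMap.opNorm_comp_le _ _).trans_lt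
      ((mul_le_of_le_one_left (norm_nonneg _) hPn).trans_lt (hR w))
  choose u hu using fun w => exists_eq_add_apply (hRP w) (kerVec H x₀)
  choose v hv using fun w => exists_eq_add_apply (hPR w) f
  simp only [ContinuousLinearMap.comp_apply] at hu hv
  have hPf : P f = 0 := by rw [hPapp, hff, one_smul, sub_self]
  have hPP : ∀ h, P (P h) = P h := fun h => by
    rw [hPapp h, map_sub, map_smul, hPf, smul_zero, sub_zero, ← hPapp]
  have hfv : ∀ w, ⟪f, v w⟫_ℂ = 1 := fun w => by
    rw [hv w, inner_add_right, hff, hPapp, inner_sub_right, inner_smul_right, hff]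
    ring
  have hPv : ∀ w, P (v w) = P (R w (v w)) := fun w => by
    conv_lhs => rw [hv w]
    rw [map_add, hPf, zero_add, hPP]
  refine ⟨fun w => ⟪u w, f⟫_ℂ, fun w => ⟪R w (v w), f⟫_ℂ, ?_, ?_, ?_, fun w => ?_⟩
  -- By `hPinner`, `⟪u x, u y⟫ = φ x * conj (φ y) + ⟪P (u x), P (u y)⟫`; the added Gram matrix
  -- cancels the `1/k` term.
  · have h1 := (posSemidef_hadamard (posSemidef_k H) (hRpos (fun _ => 1) fun w => P (u w))).add
      (posSemidef_inner fun w => P (u w))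
    convert h1 using 1
    ext x y
    have := h0 x y
    simp only [Matrix.add_apply, Matrix.hadamard_apply, Matrix.of_apply, one_smul, ← hu]
    rw [hPinner (u x) (u y), inner_conj_symm]
    simp only [map_one]
    field_simp
    ring
  · have h1 := (posSemidef_hadamard (posSemidef_k H) (hRpos (fun _ => 0) v)).add
      (posSemidef_inner v)
    convert h1 using 1
    ext x y
    have := h0 x y
    have hvx : ⟪v x, f⟫_ℂ = 1 := by rw [← inner_conj_symm, hfv, map_one]
    simp only [Matrix.add_apply, Matrix.hadamard_apply, Matrix.of_apply, zero_smul, zero_add]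
    rw [hPinner (v x) (v y), hPinner (R x (v x)) (R y (v y)), hvx, hfv, hPv, hPv, inner_conj_symm]
    field_simp
    ring
  · have : R x₀ (v x₀) = 0 := RKHS.ext fun x => by simp [hRapp, hk x]
    simp only [this, inner_zero_left]
  · have hkw : kerVec H w = kerVec H x₀ + R w (kerVec H w) := RKHS.ext fun x => by
      have := h0 x w
      simp only [RKHS.coe_add, Pi.add_apply, hRapp, kerVec_apply, hk x]
      field_simp
      ring
    set a := ⟪f, kerVec H w⟫_ℂ with ha
    -- The difference is a fixed point of the strict contraction `R w ∘L P`.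
    have hd : kerVec H w - u w - a • R w (v w) = 0 := by
      refine eq_zero_of_eq_apply (hRP w) ?_
      simp only [ContinuousLinearMap.comp_apply, map_sub, map_smul, ← hPv]
      have e1 : R w (P (kerVec H w)) = kerVec H w - kerVec H x₀ - a • R w f := by
        rw [hPapp, map_sub, map_smul, ← ha]
        nth_rewrite 2 [hkw]
        abel
      have e2 : R w (P (u w)) = u w - kerVec H x₀ := by
        nth_rewrite 2 [hu w]
        abel
      have e3 : R w (P (v w)) = R w (v w) - R w f := by
        rw [hPapp, hfv, one_smul, map_sub]
      rw [e1, e2, e3, smul_sub]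
      abel
    have h2 : a = ⟪f, u w⟫_ℂ + a * ⟪f, R w (v w)⟫_ℂ := by
      rw [sub_sub, sub_eq_zero] at hd
      rw [ha]
      nth_rewrite 1 [hd]
      rw [inner_add_right, inner_smul_right]
    have h3 := congrArg conj h2
    simp only [map_add, map_mul, inner_conj_symm, ha, inner_kerVec_left] at h3
    linear_combination h3

/-- Every function of norm at most `1` in a normalized complete Pick space is a quotient
`φ / (1 - ψ)` of contractive multipliers with `1 - ψ` cyclic and without zeros. -/
theorem IsCompletePick.exists_factorization (hH : IsCompletePick (X := X) H)
    {x₀ : X} (hk : IsNormalizedAt H x₀) (f : H) (hf : ‖f‖ ≤ 1) :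
    ∃ φ ψ : Mult (X := X) H,
      multNorm φ ≤ 1 ∧ multNorm ψ ≤ 1 ∧ (ψ : X → ℂ) x₀ = 0 ∧ IsCyclicMult (1 - ψ) ∧
        (∀ x : X, 1 - (ψ : X → ℂ) x ≠ 0) ∧
        ∀ x : X, f x = (φ : X → ℂ) x / (1 - (ψ : X → ℂ) x) := by
  have hmain : ∀ {g : H}, ‖g‖ = 1 → ∃ φ ψ : Mult (X := X) H,
      multNorm φ ≤ 1 ∧ multNorm ψ ≤ 1 ∧ (ψ : X → ℂ) x₀ = 0 ∧ IsCyclicMult (1 - ψ) ∧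
        (∀ x : X, 1 - (ψ : X → ℂ) x ≠ 0) ∧
        ∀ x : X, g x = (φ : X → ℂ) x / (1 - (ψ : X → ℂ) x) := by
    intro g hg
    obtain ⟨φ, ψ, hφ, hψ, hψ0, hfac⟩ := hH.exists_factorization_of_norm_eq_one hk hg
    have hne : ∀ x, 1 - ψ x ≠ 0 := by
      intro x hx
      have hx1 : ψ x = 1 := (sub_eq_zero.1 hx).symm
      -- If `ψ x = 1`, the diagonal entry at `x` is zero, but the entry at `(x, x₀)` is `1`.
      have h1 := eq_zero_of_posSemidef_of_diag_eq_zero hψ (i := x) (j := x₀) (by simp [hx1])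
      simp [hψ0, hk x] at h1
    obtain ⟨Φ, rfl, hΦ⟩ := exists_mult_of_posSemidef hφ
    obtain ⟨Ψ, rfl, hΨ⟩ := exists_mult_of_posSemidef hψ
    refine ⟨Φ, Ψ, hΦ, hΨ, hψ0, isCyclicMult_one_sub hΨ hne, hne, fun x => ?_⟩
    rw [eq_div_iff (hne x), mul_comm, hfac]
  have hsmul : ∀ (c : ℂ) (φ : Mult (X := X) H), mulOp (c • φ) = c • mulOp φ := fun c φ => by
    ext h x
    simp [mulOp_apply, mul_assoc]
  by_cases hf0 : f = 0
  · have hk1 : ‖kerVec H x₀‖ = 1 := by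
      have h1 := k_self_eq_norm_sq (H := H) x₀
      rw [hk x₀, eq_comm, Complex.ofReal_eq_one] at h1
      exact (pow_eq_one_iff_of_nonneg (norm_nonneg _) two_ne_zero).1 h1
    -- For `f = 0` any admissible `ψ` serves; the unit vector `kerVec H x₀` supplies one.
    obtain ⟨-, ψ, -, hψ, hψ0, hcyc, hne, -⟩ := hmain hk1
    refine ⟨0, ψ, ?_, hψ, hψ0, hcyc, hne, fun x => by simp [hf0]⟩
    have := hsmul 0 (0 : Mult (X := X) H)
    rw [zero_smul, zero_smul] at this
    rw [multNorm, this, norm_zero]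
    exact zero_le_one
  · obtain ⟨φ, ψ, hφ, hψ, hψ0, hcyc, hne, hfac⟩ := hmain (norm_smul_inv_norm (𝕜 := ℂ) hf0)
    refine ⟨(‖f‖ : ℂ) • φ, ψ, ?_, hψ, hψ0, hcyc, hne, fun x => ?_⟩
    · rw [multNorm, hsmul, norm_smul, Complex.norm_real, norm_norm]
      exact mul_le_one₀ hf (norm_nonneg _) hφ
    · have h1 := hfac x
      have h2 : (‖f‖ : ℂ) ≠ 0 := by simpa using hf0
      simp only [RKHS.coe_smul, Pi.smul_apply, smul_eq_mul] at h1
      change f x = (‖f‖ : ℂ) * (φ : X → ℂ) x / _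
      rw [mul_div_assoc, ← h1, ← mul_assoc]
      simp [h2]

theorem range_subset_smirnov (h : ∀ f : H, ‖f‖ ≤ 1 → ∃ φ ψ : Mult (X := X) H,
    IsCyclicMult ψ ∧ ∀ x : X, f x = (φ : X → ℂ) x / (ψ : X → ℂ) x) :
    Set.range (fun (f : H) (x : X) => f x) ⊆ smirnov (X := X) H := by
  rintro _ ⟨f, rfl⟩
  have h0 : (1 + ‖f‖ : ℂ) ≠ 0 := by
    have : (0 : ℝ) < 1 + ‖f‖ := by positivity
    exact_mod_cast this.ne'
  -- Scaling by `1 + ‖f‖` instead of `‖f‖` covers `f = 0` as well.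
  obtain ⟨φ, ψ, hψ, hfac⟩ := h ((1 + ‖f‖ : ℂ)⁻¹ • f) (by
    have h1 : ‖(1 + ‖f‖ : ℂ)‖ = 1 + ‖f‖ := by
      rw [← Complex.ofReal_one, ← Complex.ofReal_add, Complex.norm_real, Real.norm_of_nonneg]
      positivity
    rw [norm_smul, norm_inv, h1, inv_mul_le_one₀ (by positivity)]
    linarith)
  refine ⟨(1 + ‖f‖ : ℂ) • φ, ψ, hψ, funext fun x => ?_⟩
  have h1 := hfac x
  simp only [RKHS.coe_smul, Pi.smul_apply, smul_eq_mul] at h1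
  change f x = (1 + ‖f‖ : ℂ) * (φ : X → ℂ) x / _
  rw [mul_div_assoc, ← h1, mul_inv_cancel_left₀ h0]

end Factorization

end PickSpace

theorem theorem1p1 {X : Type*} {H : Type*} [NormedAddCommGroup H] [InnerProductSpace ℂ H]
    [CompleteSpace H] [RKHS ℂ H X ℂ] (hP : PickSpace.IsCompletePick (X := X) H)
    (x₀ : X) (hk : PickSpace.IsNormalizedAt H x₀) :
    (∀ f : H, ‖f‖ ≤ 1 →
      ∃ φ ψ : PickSpace.Mult (X := X) H,
        PickSpace.multNorm φ ≤ 1 ∧ PickSpace.multNorm ψ ≤ 1 ∧ (ψ : X → ℂ) x₀ = 0 ∧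
        PickSpace.IsCyclicMult (1 - ψ) ∧
        (∀ x : X, 1 - (ψ : X → ℂ) x ≠ 0) ∧
        ∀ x : X, f x = (φ : X → ℂ) x / (1 - (ψ : X → ℂ) x)) ∧
    Set.range (fun (f : H) (x : X) => f x) ⊆ PickSpace.smirnov (X := X) H := by
  refine ⟨hP.exists_factorization hk, PickSpace.range_subset_smirnov fun f hf => ?_⟩
  obtain ⟨φ, ψ, -, -, -, hcyc, -, hfac⟩ := hP.exists_factorization hk f hf
  exact ⟨φ, 1 - ψ, hcyc, hfac⟩
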